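/- Let $A$ be a unital C*-algebra with a tracial state $\tau$ (for example a finite von Neumann algebra with a faithful tracial state). The distribution of a self-adjoint $x\in A$ is the unique compactly supported probability measure $\mu_x$ on $\mathbb R$ with $\tau(x^n)=\int s^n\,d\mu_x(s)$ for all $n\ge 0$. Elements $x,y\in A$ are called free if the unital $*$-subalgebras $B_1,B_2$ generated by $x$ and by $y$ are free, i.e. $\tau(z_1\cdots z_n)=0$ whenever $n\ge1$, $z_j\in B_{i_j}$, $\tau(z_j)=0$ for all $j$, and $i_j\neq i_{j+1}$ for $1\le j<n$. For $t\ge 0$, a semicircular element of variance $t$ is a self-adjoint element whose distribution is the image of the standard semicircle law $\frac1{2\pi}\sqrt{4-x^2}\,dx$ on $[-2,2]$ under $x\mapsto\sqrt t\,x$; a circular element of variance $t$ is an element of the form $X+iY$, where $X,Y$ are free semicircular elements of variance $t/2$. Write $|x|=(x^*x)^{1/2}$. Let $t\ge0$, let $a\in A$ be self-adjoint with symmetric distribution (i.e. $\mu_a$ is invariant under $s\mapsto -s$), let $S\in A$ be a semicircular element of variance $t$ and $C\in A$ a circular element of variance $t$. Assume that $a$ is free from $S$ and that $a$ is free from $C$.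 Then $|a+S|$ and $\big||a|+C\big|$ have the same distribution: $\mu_{|a+S|}=\mu_{||a|+C|}$. -/

import Mathlib

open MeasureTheory

namespace FreeProb

/-- A tracial state on a unital C*-algebra: a unital positive linear functional `τ`
with `τ (x * y) = τ (y * x)`. -/
structure IsTracialState {A : Type*} [CStarAlgebra A] (τ : A →ₗ[ℂ] ℂ) : Prop where
  map_one : τ 1 = 1
  re_nonneg : ∀ x : A, 0 ≤ (τ (star x * x)).re
  im_eq_zero : ∀ x : A, (τ (star x * x)).im = 0
  map_mul_comm : ∀ x y : A, τ (x * y) = τ (y * x)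

/-- `x` is self-adjoint and its distribution (spectral measure) with respect to `τ` is `μ`:
the compactly supported probability measure on the real line with `τ (x ^ n) = ∫ s ^ n dμ(s)`
for all `n`. -/
structure HasDistribution {A : Type*} [CStarAlgebra A] (τ : A →ₗ[ℂ] ℂ) (x : A)
    (μ : Measure ℝ) : Prop where
  isSelfAdjoint : IsSelfAdjoint x
  isProbabilityMeasure : IsProbabilityMeasure μ
  compact_support : ∃ K : Set ℝ, IsCompact K ∧ μ Kᶜ = 0
  moments : ∀ n : ℕ, τ (x ^ n) = ((∫ s : ℝ, s ^ n ∂μ : ℝ) : ℂ)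

/-- Two self-adjoint elements have the same distribution. -/
def SameDistribution {A : Type*} [CStarAlgebra A] (τ : A →ₗ[ℂ] ℂ) (x y : A) : Prop :=
  ∃ μ : Measure ℝ, HasDistribution τ x μ ∧ HasDistribution τ y μ

/-- `x` is self-adjoint and its distribution is invariant under `s ↦ -s`. -/
def IsSymmetricallyDistributed {A : Type*} [CStarAlgebra A] (τ : A →ₗ[ℂ] ℂ) (x : A) : Prop :=
  ∃ μ : Measure ℝ, HasDistribution τ x μ ∧ μ.map (fun s : ℝ => -s) = μ

/-- Freeness of a family of unital *-subalgebras: an alternating product of centered elements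
is centered. -/
def FreeSubalgebras {A : Type*} [CStarAlgebra A] (τ : A →ₗ[ℂ] ℂ) {ι : Type*}
    (B : ι → StarSubalgebra ℂ A) : Prop :=
  ∀ l : List (ι × A), l ≠ [] →
    (∀ p ∈ l, p.2 ∈ B p.1 ∧ τ p.2 = 0) →
    l.IsChain (fun p q => p.1 ≠ q.1) →
    τ (l.map Prod.snd).prod = 0

/-- *-freeness of a family of elements: the unital *-subalgebras they generate are free. -/
def StarFree {A : Type*} [CStarAlgebra A] (τ : A →ₗ[ℂ] ℂ) {ι : Type*} (x : ι → A) : Prop :=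
  FreeSubalgebras τ (fun i => StarAlgebra.adjoin ℂ {x i})

/-- The standard semicircle law, with density `√(4 - x²) / (2π)` on `[-2, 2]`
(the real square root vanishes on negative numbers). -/
noncomputable def standardSemicircleLaw : Measure ℝ :=
  volume.withDensity (fun x : ℝ => ENNReal.ofReal (√(4 - x ^ 2) / (2 * Real.pi)))

/-- The semicircle law of variance `t ≥ 0`: the standard one dilated by `√t`. -/
noncomputable def semicircleLaw (t : ℝ) : Measure ℝ :=
  standardSemicircleLaw.map (fun x : ℝ => √t * x)

/-- A semicircular element of variance `t`. -/
def IsSemicircular {A : Type*} [CStarAlgebra A] (τ : A →ₗ[ℂ] ℂ) (t : ℝ) (S : A) : Prop :=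
  HasDistribution τ S (semicircleLaw t)

/-- A circular element of variance `t`: `C = X + i Y` with `X`, `Y` free semicircular elements
of variance `t / 2`, so that `τ (C* C) = t`. Since `X` and `Y` are the real and imaginary parts
of `C`, this is a condition on the *-distribution of `C`. -/
def IsCircular {A : Type*} [CStarAlgebra A] (τ : A →ₗ[ℂ] ℂ) (t : ℝ) (C : A) : Prop :=
  ∃ X Y : A, IsSemicircular τ (t / 2) X ∧ IsSemicircular τ (t / 2) Y ∧
    StarFree τ ![X, Y] ∧ C = X + Complex.I • Y

end FreeProb

/-! Put `q = |a|`. The even moments of `|a + S|` are traces of `(a + S) ^ (2n)`, a sum of words in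
`a` and `S`; those of `|q + C|` are traces of `((q + C*)(q + C)) ^ n`, a sum of words in `q`, `C*`,
`C` in which the position's parity decides between `C*` and `C`. It suffices to match these word by
word.

Both kinds of word obey a Schwinger-Dyson equation. For `S` it reads `τ(S w) = t ∑ τ(u) τ(v)` over
all splittings `w = u S v` (`semicircular_word`); for `C` only the splittings `w = u C* v` count,
and conversely (`circular_word`). Since `a` is symmetric, induction on the number of letters `S`
kills all words of odd length. Hence a splitting of `S u S v` contributes only when `u` has even
length, so that the two letters `S` sit at positions of opposite parity: exactly where the other
word has a `C` and a `C*`. Both recursions therefore agree on words of even length (`traceWord_eq`),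
starting from `τ(a ^ n) = τ(|a| ^ n)` for even `n`.

The Schwinger-Dyson equation for a single semicircular element is the Catalan recursion of its
moments. Freeness extends it to the generated algebra (`schwingerDyson_iSup`), since the derivation
vanishes on the other free factors. Derivations live on a free algebra, where they always exist, and
traces are pulled back to it. Finally, equality of the moments of `|x| ^ 2` passes to `|x|` by
polynomial approximation of the square root. -/

namespace FreeProb
open TensorProduct

/-! ### Schwinger-Dyson equations and freeness -/

section SchwingerDyson

variable {F : Type*} [Ring F] [Algebra ℂ F] {ι : Type*}

/-- A derivation of `F` into the bimodule `F ⊗ F`. -/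
def IsBiderivation (D : F →ₗ[ℂ] F ⊗[ℂ] F) : Prop :=
  ∀ p q : F, D (p * q) = D p * (1 ⊗ₜ q) + (p ⊗ₜ 1) * D q

lemma IsBiderivation.map_one {D : F →ₗ[ℂ] F ⊗[ℂ] F} (hD : IsBiderivation D) : D 1 = 0 := by
  have h := hD 1 1
  rw [← Algebra.TensorProduct.one_def, mul_one, mul_one, one_mul] at h
  exact left_eq_add.mp h

lemma IsBiderivation.map_mem {D : F →ₗ[ℂ] F ⊗[ℂ] F} (hD : IsBiderivation D) {s : Set F}
    {B : Subalgebra ℂ F} (hB : B = Algebra.adjoin ℂ s) (hs : ∀ x ∈ s, ∃ c : ℂ, D x = c • 1)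
    {x : F} (hx : x ∈ B) :
    D x ∈ Submodule.span ℂ {y | ∃ c ∈ B, ∃ d ∈ B, y = c ⊗ₜ[ℂ] d} := by
  have h1 : (1 : F ⊗[ℂ] F) ∈ Submodule.span ℂ {y | ∃ c ∈ B, ∃ d ∈ B, y = c ⊗ₜ[ℂ] d} :=
    Submodule.subset_span ⟨1, one_mem _, 1, one_mem _, Algebra.TensorProduct.one_def⟩
  rw [hB] at hx
  induction hx using Algebra.adjoin_induction with
  | mem x hx =>
    obtain ⟨c, hc⟩ := hs x hx
    exact hc ▸ Submodule.smul_mem _ _ h1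
  | algebraMap r =>
    rw [Algebra.algebraMap_eq_smul_one, map_smul, hD.map_one, smul_zero]
    exact zero_mem _
  | add x y _ _ hx hy => exact map_add D x y ▸ add_mem hx hy
  | mul x y hxB hyB hx hy =>
    rw [← hB] at hxB hyB
    rw [hD]
    refine add_mem ?_ ?_
    · refine Submodule.span_induction (p := fun z _ => z * (1 ⊗ₜ y) ∈ _) ?_ ?_ ?_ ?_ hx
      · rintro _ ⟨c, hc, d, hd, rfl⟩
        rw [Algebra.TensorProduct.tmul_mul_tmul, mul_one]
        exact Submodule.subset_span ⟨c, hc, _, mul_mem hd hyB, rfl⟩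
      · rw [zero_mul]; exact zero_mem _
      · intro _ _ _ _ h h'; rw [add_mul]; exact add_mem h h'
      · intro r _ _ h; rw [smul_mul_assoc]; exact Submodule.smul_mem _ _ h
    · refine Submodule.span_induction (p := fun z _ => (x ⊗ₜ 1) * z ∈ _) ?_ ?_ ?_ ?_ hy
      · rintro _ ⟨c, hc, d, hd, rfl⟩
        rw [Algebra.TensorProduct.tmul_mul_tmul, one_mul]
        exact Submodule.subset_span ⟨_, mul_mem hxB hc, d, hd, rfl⟩
      · rw [mul_zero]; exact zero_mem _
      · intro _ _ _ _ h h'; rw [mul_add]; exact add_mem h h'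
      · intro r _ _ h; rw [mul_smul_comm]; exact Submodule.smul_mem _ _ h

lemma IsBiderivation.eq_zero_of_adjoin {D : F →ₗ[ℂ] F ⊗[ℂ] F} (hD : IsBiderivation D)
    {s : Set F} (hs : ∀ x ∈ s, D x = 0) {x : F} (hx : x ∈ Algebra.adjoin ℂ s) : D x = 0 := by
  induction hx using Algebra.adjoin_induction with
  | mem x hx => exact hs x hx
  | algebraMap r => rw [Algebra.algebraMap_eq_smul_one, map_smul, hD.map_one, smul_zero]
  | add x y _ _ hx hy => rw [map_add, hx, hy, add_zero]
  | mul x y _ _ hx hy => rw [hD, hx, hy, zero_mul, mul_zero, add_zero]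

/-- The functional `φ ⊗ φ`. -/
noncomputable def tensorSquare (φ : F →ₗ[ℂ] ℂ) : F ⊗[ℂ] F →ₗ[ℂ] ℂ :=
  LinearMap.mul' ℂ ℂ ∘ₗ TensorProduct.map φ φ

@[simp] lemma tensorSquare_tmul (φ : F →ₗ[ℂ] ℂ) (x y : F) :
    tensorSquare φ (x ⊗ₜ y) = φ x * φ y := by
  simp [tensorSquare]

/-- A list of centered elements of the subalgebras `B i`, neighbours coming from different ones. -/
def IsAlternating (φ : F →ₗ[ℂ] ℂ) (B : ι → Subalgebra ℂ F) (l : List (ι × F)) : Prop :=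
  (∀ p ∈ l, p.2 ∈ B p.1 ∧ φ p.2 = 0) ∧ l.IsChain (fun p q => p.1 ≠ q.1)

/-- Freeness of a family of subalgebras. -/
def IsFreeFamily (φ : F →ₗ[ℂ] ℂ) (B : ι → Subalgebra ℂ F) : Prop :=
  ∀ l : List (ι × F), l ≠ [] → IsAlternating φ B l → φ (l.map Prod.snd).prod = 0

variable {φ : F →ₗ[ℂ] ℂ} {B : ι → Subalgebra ℂ F}

lemma IsAlternating.tail {p : ι × F} {l : List (ι × F)} (h : IsAlternating φ B (p :: l)) :
    IsAlternating φ B l :=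
  ⟨fun q hq => h.1 q (List.mem_cons_of_mem _ hq), h.2.tail⟩

lemma IsAlternating.cons {l : List (ι × F)} (h : IsAlternating φ B l) {i : ι} {x : F}
    (hx : x ∈ B i) (hx0 : φ x = 0) (hi : ∀ p ∈ l.head?, i ≠ p.1) :
    IsAlternating φ B ((i, x) :: l) := by
  refine ⟨?_, List.isChain_cons.mpr ⟨hi, h.2⟩⟩
  rintro p (_ | ⟨_, hp⟩)
  exacts [⟨hx, hx0⟩, h.1 p hp]

lemma IsAlternating.head_ne {p : ι × F} {l : List (ι × F)} (h : IsAlternating φ B (p :: l)) :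
    ∀ q ∈ l.head?, p.1 ≠ q.1 :=
  (List.isChain_cons.mp h.2).1

section

variable (hφ : φ 1 = 1)
include hφ

lemma map_center (x : F) : φ (x - φ x • 1) = 0 := by
  rw [map_sub, map_smul, hφ, smul_eq_mul, mul_one, sub_self]

omit hφ in
lemma center_mem {C : Subalgebra ℂ F} {x : F} (hx : x ∈ C) (c : ℂ) : x - c • 1 ∈ C :=
  sub_mem hx (C.smul_mem (one_mem _) _)

/-- Split `x` into its centred part and a scalar: either way an alternating product of centred
elements remains. -/
lemma IsFreeFamily.map_mul_prod (hB : IsFreeFamily φ B) {i : ι} {x : F} (hx : x ∈ B i)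
    {l : List (ι × F)} (hl : IsAlternating φ B l) (hl0 : l ≠ []) (hi : ∀ p ∈ l.head?, i ≠ p.1) :
    φ (x * (l.map Prod.snd).prod) = 0 := by
  have h := hB _ (List.cons_ne_nil _ _)
    (hl.cons (center_mem hx (φ x)) (map_center hφ x) hi)
  rw [List.map_cons, List.prod_cons, sub_mul, map_sub, smul_mul_assoc, one_mul, map_smul,
    hB l hl0 hl, smul_zero, sub_zero] at h
  exact h

/-- Mirror image of `IsFreeFamily.map_mul_prod`. The element `y` only records that a letter with
index `i` may follow `l`. -/
lemma IsFreeFamily.map_prod_mul (hB : IsFreeFamily φ B) {i : ι} {x y : F} (hx : x ∈ B i)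
    {l : List (ι × F)} (hl : IsAlternating φ B (l ++ [(i, y)])) (hl0 : l ≠ []) :
    φ ((l.map Prod.snd).prod * x) = 0 := by
  have hl' : IsAlternating φ B l :=
    ⟨fun p hp => hl.1 p (List.mem_append_left _ hp), hl.2.left_of_append⟩
  have hl2 : IsAlternating φ B (l ++ [(i, x - φ x • 1)]) := by
    refine ⟨?_, ?_⟩
    · intro p hp
      rcases List.mem_append.mp hp with hp | hp
      · exact hl'.1 p hp
      · rw [List.mem_singleton.mp hp]
        exact ⟨center_mem hx _, map_center hφ x⟩
    · have := List.isChain_append.mp hl.2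
      refine List.isChain_append.mpr ⟨this.1, List.isChain_singleton _, ?_⟩
      simpa using this.2.2
  have h := hB _ (by simp) hl2
  rw [List.map_append, List.prod_append, List.map_singleton, List.prod_singleton, mul_sub,
    map_sub, mul_smul_comm, mul_one, map_smul, hB l hl0 hl', smul_zero, sub_zero] at h
  exact h

/-- The span of the alternating products is stable under multiplication by elements of the
given subalgebras. -/
lemma mul_mem_span_alternating {i : ι} {x : F} (hx : x ∈ B i) {p : F}
    (hp : p ∈ Submodule.span ℂ {p | ∃ l, IsAlternating φ B l ∧ p = (l.map Prod.snd).prod}) :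
    x * p ∈ Submodule.span ℂ {p | ∃ l, IsAlternating φ B l ∧ p = (l.map Prod.snd).prod} := by
  refine Submodule.span_induction (p := fun p _ => x * p ∈ _) ?_ ?_ ?_ ?_ hp
  · rintro _ ⟨l, hl, rfl⟩
    by_cases hi : ∀ p ∈ l.head?, i ≠ p.1
    · have h : x * (l.map Prod.snd).prod = (((i, x - φ x • 1) :: l).map Prod.snd).prod
          + φ x • (l.map Prod.snd).prod := by
        rw [List.map_cons, List.prod_cons, sub_mul, smul_mul_assoc, one_mul, sub_add_cancel]
      rw [h]
      exact add_mem (Submodule.subset_span ⟨_, hl.cons (center_mem hx _) (map_center hφ x) hi, rfl⟩)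
        (Submodule.smul_mem _ _ (Submodule.subset_span ⟨l, hl, rfl⟩))
    -- The head of the word lies in the same subalgebra as `x`: merge the two and recentre. The
    -- scalar left over multiplies the tail, which is again alternating.
    · match l, hl, hi with
      | [], _, hi => simp at hi
      | (j, z) :: l, hl, hi =>
        obtain rfl : i = j := by simpa using hi
        have hz : x * z ∈ B i := mul_mem hx (hl.1 _ List.mem_cons_self).1
        have h : x * (((i, z) :: l).map Prod.snd).prod =
            (((i, x * z - φ (x * z) • 1) :: l).map Prod.snd).prod
              + φ (x * z) • (l.map Prod.snd).prod := by
          simp only [List.map_cons, List.prod_cons, sub_mul, smul_mul_assoc, one_mul,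
            sub_add_cancel, mul_assoc]
        rw [h]
        exact add_mem (Submodule.subset_span
          ⟨_, hl.tail.cons (center_mem hz _) (map_center hφ _) hl.head_ne, rfl⟩)
          (Submodule.smul_mem _ _ (Submodule.subset_span ⟨l, hl.tail, rfl⟩))
  · rw [mul_zero]; exact zero_mem _
  · intro _ _ _ _ h h'; rw [mul_add]; exact add_mem h h'
  · intro r _ _ h; rw [mul_smul_comm]; exact Submodule.smul_mem _ _ h

/-- The elements whose left multiplication preserves the span form a subalgebra containing every `B
i`; apply such an element to the empty product `1`. -/
lemma mem_span_alternating {p : F} (hp : p ∈ ⨆ i, B i) :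
    p ∈ Submodule.span ℂ {p | ∃ l, IsAlternating φ B l ∧ p = (l.map Prod.snd).prod} := by
  set W := Submodule.span ℂ {p | ∃ l, IsAlternating φ B l ∧ p = (l.map Prod.snd).prod}
  let M : Subalgebra ℂ F :=
    { carrier := {p | ∀ q ∈ W, p * q ∈ W}
      mul_mem' := fun {a b} ha hb q hq => by rw [mul_assoc]; exact ha _ (hb _ hq)
      add_mem' := fun {a b} ha hb q hq => by rw [add_mul]; exact add_mem (ha _ hq) (hb _ hq)
      algebraMap_mem' := fun r q hq => by
        rw [← Algebra.smul_def]; exact Submodule.smul_mem _ _ hq }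
  have hM : ⨆ i, B i ≤ M := iSup_le fun i x hx q hq => mul_mem_span_alternating hφ hx hq
  have h1 : (1 : F) ∈ W := Submodule.subset_span ⟨[], ⟨by simp, List.isChain_nil⟩, by simp⟩
  simpa using hM hp 1 h1

variable (hB : IsFreeFamily φ B) {D : F →ₗ[ℂ] F ⊗[ℂ] F} (hD : IsBiderivation D) {i : ι}
  (hDi : ∀ x ∈ B i, D x ∈ Submodule.span ℂ {y | ∃ c ∈ B i, ∃ d ∈ B i, y = c ⊗ₜ[ℂ] d})
  (hDj : ∀ j ≠ i, ∀ x ∈ B j, D x = 0)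
include hB hD hDi hDj

/-- Differentiating a letter from `B i` leaves on the left tensor leg a nonempty alternating word
followed by an element of `B i`, which `φ` kills. So in an alternating word only the first letter
can contribute. -/
lemma tensorSquare_alternating (l : List (ι × F)) : ∀ u : List (ι × F), u ≠ [] →
    IsAlternating φ B (u ++ l) →
    tensorSquare φ (((u.map Prod.snd).prod ⊗ₜ 1) * D (l.map Prod.snd).prod) = 0 := by
  induction l with
  | nil => intro u _ _; rw [List.map_nil, List.prod_nil, hD.map_one, mul_zero, map_zero]
  | cons p l ih =>
    obtain ⟨j, z⟩ := p
    intro u hu hul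
    have hul' : IsAlternating φ B ((u ++ [(j, z)]) ++ l) := by simpa using hul
    have h2 := ih _ (by simp) hul'
    rw [List.map_append, List.prod_append, List.map_singleton, List.prod_singleton] at h2
    rw [List.map_cons, List.prod_cons, hD, mul_add, ← mul_assoc (_ ⊗ₜ[ℂ] _) (_ ⊗ₜ[ℂ] _),
      Algebra.TensorProduct.tmul_mul_tmul, one_mul, map_add, h2, add_zero]
    have hz : z ∈ B j := (hul.1 (j, z) (by simp)).1
    by_cases hj : j = i
    · subst hj
      refine Submodule.span_induction
        (p := fun y _ => tensorSquare φ (_ * (y * _)) = 0) ?_ ?_ ?_ ?_ (hDi z hz)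
      · rintro _ ⟨c, hc, d, hd, rfl⟩
        have hu2 : IsAlternating φ B (u ++ [(j, z)]) :=
          ⟨fun p hp => hul'.1 p (List.mem_append_left _ hp), hul'.2.left_of_append⟩
        simp only [Algebra.TensorProduct.tmul_mul_tmul, tensorSquare_tmul, mul_one, one_mul]
        rw [hB.map_prod_mul hφ hc hu2 hu, zero_mul]
      · rw [zero_mul, mul_zero, map_zero]
      · intro _ _ _ _ h h'; rw [add_mul, mul_add, map_add, h, h', add_zero]
      · intro r _ _ h; rw [smul_mul_assoc, mul_smul_comm, map_smul, h, smul_zero]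
    · rw [hDj j hj z hz, zero_mul, mul_zero, map_zero]

/-- A Schwinger-Dyson equation on one of several free subalgebras holds on the algebra they
generate. -/
theorem schwingerDyson_iSup {s : F} (hs : s ∈ B i)
    (hsd : ∀ x ∈ B i, φ (s * x) = tensorSquare φ (D x)) {p : F} (hp : p ∈ ⨆ i, B i) :
    φ (s * p) = tensorSquare φ (D p) := by
  refine Submodule.span_induction (p := fun p _ => φ (s * p) = tensorSquare φ (D p))
    ?_ ?_ ?_ ?_ (mem_span_alternating hφ hp)
  · rintro _ ⟨l, hl, rfl⟩
    match l, hl with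
    | [], _ => exact hsd 1 (one_mem _)
    | (j, z) :: l, hl =>
      have hz : z ∈ B j := (hl.1 (j, z) (by simp)).1
      have h2 := tensorSquare_alternating hφ hB hD hDi hDj l [(j, z)] (by simp) hl
      rw [List.map_singleton, List.prod_singleton] at h2
      rw [List.map_cons, List.prod_cons, hD, map_add, h2, add_zero]
      by_cases hj : j = i
      · subst hj
        by_cases hl0 : l = []
        · subst hl0
          rw [List.map_nil, List.prod_nil, mul_one, ← Algebra.TensorProduct.one_def, mul_one]
          exact hsd z hz
        · rw [← mul_assoc, hB.map_mul_prod hφ (mul_mem hs hz) hl.tail hl0 hl.head_ne]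
          symm
          refine Submodule.span_induction
            (p := fun y _ => tensorSquare φ (y * _) = 0) ?_ ?_ ?_ ?_ (hDi z hz)
          · rintro _ ⟨c, hc, d, hd, rfl⟩
            rw [Algebra.TensorProduct.tmul_mul_tmul, tensorSquare_tmul,
              hB.map_mul_prod hφ hd hl.tail hl0 hl.head_ne, mul_zero]
          · rw [zero_mul, map_zero]
          · intro _ _ _ _ h h'; rw [add_mul, map_add, h, h', add_zero]
          · intro r _ _ h; rw [smul_mul_assoc, map_smul, h, smul_zero]
      · rw [hDj j hj z hz, zero_mul, map_zero]
        have := hB.map_mul_prod hφ hs hl (by simp) (by simpa using Ne.symm hj)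
        simpa using this
  · rw [mul_zero, map_zero, map_zero, map_zero]
  · intro _ _ _ _ h h'; rw [mul_add, map_add, map_add, map_add, h, h']
  · intro r _ _ h; rw [mul_smul_comm, map_smul, map_smul, map_smul, h]

end

end SchwingerDyson


/-! ### Moments of the semicircle law and the Catalan recursion -/

section SemicircleMoments

/-- Unnormalized moments of the standard semicircle law. -/
noncomputable def semicircleIntegral (n : ℕ) : ℝ := ∫ x in (-2 : ℝ)..2, x ^ n * √(4 - x ^ 2)

lemma hasDerivAt_mul_sqrt (g : ℝ → ℝ) (g' x : ℝ) (hg : HasDerivAt g g' x) (hx : 0 < 4 - x ^ 2) :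
    HasDerivAt (fun x => g x * ((4 - x ^ 2) * √(4 - x ^ 2)))
      ((g' * (4 - x ^ 2) - 3 * x * g x) * √(4 - x ^ 2)) x := by
  have h1 : HasDerivAt (fun x : ℝ => 4 - x ^ 2) (-(2 * x)) x := by
    simpa using (hasDerivAt_pow 2 x).const_sub 4
  have h2 := h1.sqrt hx.ne'
  have h3 := hg.mul (h1.mul h2)
  refine h3.congr_deriv ?_
  have hs : √(4 - x ^ 2) ≠ 0 := (Real.sqrt_pos.mpr hx).ne'
  have hs2 : √(4 - x ^ 2) ^ 2 = 4 - x ^ 2 := Real.sq_sqrt hx.le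
  simp only [Pi.mul_apply]
  field_simp
  rw [hs2]
  ring

/-- The integrand is the derivative of `g x * (4 - x ^ 2) ^ (3 / 2)`, which vanishes at both
endpoints. With `g` a power of `x` this yields the recursion for the moments. -/
lemma integral_deriv_mul_sqrt (g g' : ℝ → ℝ) (hg : ∀ x, HasDerivAt g (g' x) x)
    (hg' : Continuous g') :
    ∫ x in (-2 : ℝ)..2, (g' x * (4 - x ^ 2) - 3 * x * g x) * √(4 - x ^ 2) = 0 := by
  have hgc : Continuous g := continuous_iff_continuousAt.mpr fun x => (hg x).continuousAt
  rw [intervalIntegral.integral_eq_sub_of_hasDerivAt_of_le (by norm_num)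
    (f := fun x => g x * ((4 - x ^ 2) * √(4 - x ^ 2)))
    (by fun_prop) (fun x hx => hasDerivAt_mul_sqrt g (g' x) x (hg x) (by nlinarith [hx.1, hx.2]))
    (Continuous.intervalIntegrable (by fun_prop) _ _)]
  norm_num

lemma semicircleIntegral_one : semicircleIntegral 1 = 0 := by
  have h := integral_deriv_mul_sqrt (fun _ => 1) (fun _ => 0) (fun x => hasDerivAt_const x 1)
    continuous_const
  have h2 : (fun x : ℝ => ((0 : ℝ) * (4 - x ^ 2) - 3 * x * 1) * √(4 - x ^ 2)) =
      fun x => (-3) * (x ^ 1 * √(4 - x ^ 2)) := by ext x; ring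
  rw [h2, intervalIntegral.integral_const_mul] at h
  simpa [semicircleIntegral] using h

lemma semicircleIntegral_add_two (n : ℕ) :
    (n + 4) * semicircleIntegral (n + 2) = 4 * (n + 1) * semicircleIntegral n := by
  have h := integral_deriv_mul_sqrt (fun x => x ^ (n + 1)) (fun x => (n + 1) * x ^ n)
    (fun x => by simpa using hasDerivAt_pow (n + 1) x) (by fun_prop)
  have h2 : (fun x : ℝ => ((n + 1) * x ^ n * (4 - x ^ 2) - 3 * x * x ^ (n + 1)) * √(4 - x ^ 2)) =
      fun x => (4 * (n + 1)) * (x ^ n * √(4 - x ^ 2)) - (n + 4) * (x ^ (n + 2) * √(4 - x ^ 2)) := by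
    ext x; ring
  rw [h2, intervalIntegral.integral_sub (Continuous.intervalIntegrable (by fun_prop) _ _)
    (Continuous.intervalIntegrable (by fun_prop) _ _), intervalIntegral.integral_const_mul,
    intervalIntegral.integral_const_mul] at h
  simp only [semicircleIntegral]
  linarith

lemma semicircleIntegral_zero : semicircleIntegral 0 = 2 * Real.pi := by
  have h := intervalIntegral.integral_comp_mul_left (a := -1) (b := 1)
    (fun x => √(4 - x ^ 2)) (two_ne_zero (α := ℝ))
  have h2 : (fun x : ℝ => √(4 - (2 * x) ^ 2)) = fun x => 2 * √(1 - x ^ 2) := by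
    ext x
    rw [show 4 - (2 * x) ^ 2 = 2 ^ 2 * (1 - x ^ 2) by ring, Real.sqrt_mul (by norm_num),
      Real.sqrt_sq (by norm_num)]
  rw [h2, intervalIntegral.integral_const_mul, integral_sqrt_one_sub_sq] at h
  norm_num at h
  simp only [semicircleIntegral, pow_zero, one_mul]
  linarith

lemma semicircleIntegral_odd (k : ℕ) : semicircleIntegral (2 * k + 1) = 0 := by
  induction k with
  | zero => exact semicircleIntegral_one
  | succ k ih =>
    have h := semicircleIntegral_add_two (2 * k + 1)
    rw [ih, mul_zero] at h
    exact (mul_eq_zero.mp h).resolve_left (by positivity)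

lemma semicircleIntegral_even (k : ℕ) :
    semicircleIntegral (2 * k) = 2 * Real.pi * catalan k := by
  induction k with
  | zero => simp [semicircleIntegral_zero]
  | succ k ih =>
    have h := semicircleIntegral_add_two (2 * k)
    rw [ih] at h
    have h1 : ((k : ℝ) + 1) * catalan k = k.centralBinom := by
      exact_mod_cast succ_mul_catalan_eq_centralBinom k
    have h2 : ((k : ℝ) + 1 + 1) * catalan (k + 1) = (k + 1).centralBinom := by
      exact_mod_cast succ_mul_catalan_eq_centralBinom (k + 1)
    have h3 : ((k : ℝ) + 1) * (k + 1).centralBinom = 2 * (2 * k + 1) * k.centralBinom := by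
      exact_mod_cast Nat.succ_mul_centralBinom_succ k
    rw [← h1, ← h2] at h3
    have hk : (k : ℝ) + 1 ≠ 0 := by positivity
    have h4 : ((k : ℝ) + 2) * catalan (k + 1) = 2 * (2 * k + 1) * catalan k := by
      apply mul_left_cancel₀ hk; linarith
    have hk2 : (2 * (k : ℝ) + 4) ≠ 0 := by positivity
    rw [show 2 * (k + 1) = 2 * k + 2 by ring]
    apply mul_left_cancel₀ hk2
    push_cast at h
    rw [h]
    linear_combination (-4 * Real.pi) * h4

/-- Moments of the standard semicircle law. -/
noncomputable def semicircleMoment (n : ℕ) : ℝ := semicircleIntegral n / (2 * Real.pi)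

lemma semicircleMoment_even (k : ℕ) : semicircleMoment (2 * k) = catalan k := by
  rw [semicircleMoment, semicircleIntegral_even, mul_div_cancel_left₀ _ (by positivity)]

lemma semicircleMoment_odd (k : ℕ) : semicircleMoment (2 * k + 1) = 0 := by
  rw [semicircleMoment, semicircleIntegral_odd, zero_div]

/-- For even `n` this is Segner's recursion for the Catalan numbers, the terms with odd indices
being zero; for odd `n` each term has an odd index. -/
lemma semicircleMoment_add_two (n : ℕ) : semicircleMoment (n + 2) =
    ∑ p ∈ Finset.HasAntidiagonal.antidiagonal n, semicircleMoment p.1 * semicircleMoment p.2 := by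
  rcases Nat.even_or_odd' n with ⟨k, rfl | rfl⟩
  · rw [show 2 * k + 2 = 2 * (k + 1) by ring, semicircleMoment_even, catalan_succ', Nat.cast_sum]
    refine Finset.sum_of_injOn (fun p : ℕ × ℕ => (2 * p.1, 2 * p.2)) ?_ ?_ ?_ ?_
    · rintro ⟨a, b⟩ _ ⟨c, d⟩ _ h
      simp only [Prod.mk.injEq] at h ⊢
      omega
    · rintro ⟨a, b⟩ h
      simp only [Finset.mem_coe, Finset.HasAntidiagonal.mem_antidiagonal] at h ⊢
      omega
    · rintro ⟨a, b⟩ h h2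
      rcases Nat.even_or_odd' a with ⟨c, rfl | rfl⟩
      · rcases Nat.even_or_odd' b with ⟨d, rfl | rfl⟩
        · refine absurd ⟨(c, d), ?_, rfl⟩ h2
          simp only [Finset.mem_coe, Finset.HasAntidiagonal.mem_antidiagonal] at h ⊢
          omega
        · rw [semicircleMoment_odd d, mul_zero]
      · rw [semicircleMoment_odd c, zero_mul]
    · rintro ⟨a, b⟩ _
      rw [semicircleMoment_even, semicircleMoment_even, Nat.cast_mul]
  · rw [show 2 * k + 1 + 2 = 2 * (k + 1) + 1 by ring, semicircleMoment_odd]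
    symm
    refine Finset.sum_eq_zero ?_
    rintro ⟨a, b⟩ h
    rw [Finset.HasAntidiagonal.mem_antidiagonal] at h
    rcases Nat.even_or_odd' a with ⟨c, rfl | rfl⟩
    · rcases Nat.even_or_odd' b with ⟨d, rfl | rfl⟩
      · omega
      · rw [semicircleMoment_odd d, mul_zero]
    · rw [semicircleMoment_odd c, zero_mul]

lemma integral_standardSemicircleLaw (n : ℕ) :
    ∫ x, x ^ n ∂standardSemicircleLaw = semicircleMoment n := by
  rw [standardSemicircleLaw, integral_withDensity_eq_integral_toReal_smul
    (by fun_prop) (by simp)]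
  have h : (fun x : ℝ => (ENNReal.ofReal (√(4 - x ^ 2) / (2 * Real.pi))).toReal • x ^ n) =
      fun x => (x ^ n * √(4 - x ^ 2)) / (2 * Real.pi) := by
    ext x
    rw [ENNReal.toReal_ofReal (by positivity), smul_eq_mul]
    ring
  rw [h, integral_div, semicircleMoment, semicircleIntegral,
    intervalIntegral.integral_of_le (by norm_num), setIntegral_eq_integral_of_forall_compl_eq_zero]
  intro x hx
  have hx2 : 4 - x ^ 2 ≤ 0 := by
    by_contra! h
    refine hx ⟨?_, ?_⟩ <;> nlinarith
  rw [Real.sqrt_eq_zero_of_nonpos hx2, mul_zero]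

lemma integral_semicircleLaw (t : ℝ) (n : ℕ) :
    ∫ x, x ^ n ∂semicircleLaw t = √t ^ n * semicircleMoment n := by
  rw [semicircleLaw, integral_map (by fun_prop) (by fun_prop)]
  simp only [mul_pow]
  rw [integral_const_mul, integral_standardSemicircleLaw]

lemma integral_semicircleLaw_one (t : ℝ) : ∫ x, x ^ 1 ∂semicircleLaw t = 0 := by
  rw [integral_semicircleLaw, semicircleMoment_odd 0, mul_zero]

lemma integral_semicircleLaw_add_two {t : ℝ} (ht : 0 ≤ t) (n : ℕ) :
    ∫ x, x ^ (n + 2) ∂semicircleLaw t = t * ∑ p ∈ Finset.HasAntidiagonal.antidiagonal n,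
      (∫ x, x ^ p.1 ∂semicircleLaw t) * ∫ x, x ^ p.2 ∂semicircleLaw t := by
  simp only [integral_semicircleLaw]
  rw [semicircleMoment_add_two, pow_add, Real.sq_sqrt ht, mul_comm (√t ^ n), mul_assoc, Finset.mul_sum]
  congr 1
  refine Finset.sum_congr rfl fun p hp => ?_
  rw [← Finset.HasAntidiagonal.mem_antidiagonal.mp hp, pow_add]
  ring

end SemicircleMoments


/-! ### Derivations on free algebras and their values on words -/

section Biderivations

variable {F : Type*} [Ring F] [Algebra ℂ F] {L : Type*}

/-- The free algebra carries a biderivation with prescribed scalar values on the generators. -/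
lemma exists_isBiderivation (d : L → ℂ) :
    ∃ D : FreeAlgebra ℂ L →ₗ[ℂ] FreeAlgebra ℂ L ⊗[ℂ] FreeAlgebra ℂ L,
      IsBiderivation D ∧ ∀ l, D (FreeAlgebra.ι ℂ l) = d l • 1 := by
  -- The map `p ↦ !![p ⊗ 1, D p; 0, 1 ⊗ p]` is multiplicative exactly when `D` is a biderivation, so
  -- the universal property yields `D` as the upper right entry.
  let M : FreeAlgebra ℂ L →ₐ[ℂ]
      Matrix (Fin 2) (Fin 2) (FreeAlgebra ℂ L ⊗[ℂ] FreeAlgebra ℂ L) :=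
    FreeAlgebra.lift ℂ fun l => !![FreeAlgebra.ι ℂ l ⊗ₜ 1, d l • 1; 0, 1 ⊗ₜ FreeAlgebra.ι ℂ l]
  have hM : ∀ p, M p 0 0 = p ⊗ₜ 1 ∧ M p 1 0 = 0 ∧ M p 1 1 = 1 ⊗ₜ p := by
    intro p
    induction p using FreeAlgebra.induction with
    | grade0 r =>
      rw [AlgHom.commutes, Algebra.algebraMap_eq_smul_one, Algebra.algebraMap_eq_smul_one]
      simp [Algebra.TensorProduct.one_def, TensorProduct.smul_tmul']
    | grade1 l => simp [M]
    | mul p q hp hq =>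
      simp [map_mul, Matrix.mul_apply, hp.1, hp.2.1, hp.2.2, hq.1, hq.2.1, hq.2.2]
    | add p q hp hq =>
      simp [map_add, hp.1, hp.2.1, hp.2.2, hq.1, hq.2.1, hq.2.2, TensorProduct.add_tmul,
        TensorProduct.tmul_add]
  refine ⟨(Matrix.entryLinearMap ℂ _ 0 1) ∘ₗ M.toLinearMap, ?_, ?_⟩
  · intro p q
    simp only [LinearMap.comp_apply, AlgHom.toLinearMap_apply, Matrix.entryLinearMap_apply,
      map_mul, Matrix.mul_apply, Fin.sum_univ_two, (hM p).1, (hM q).2.2]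
    exact add_comm _ _
  · intro l
    simp [M]

lemma IsBiderivation.map_pow {D : F →ₗ[ℂ] F ⊗[ℂ] F} (hD : IsBiderivation D) {x : F} {c : ℂ}
    (hx : D x = c • 1) (n : ℕ) :
    D (x ^ (n + 1)) =
      c • ∑ p ∈ Finset.HasAntidiagonal.antidiagonal n, (x ^ p.1) ⊗ₜ[ℂ] (x ^ p.2) := by
  induction n with
  | zero => simp [hx, Algebra.TensorProduct.one_def]
  | succ n ih =>
    rw [pow_succ', hD, hx, ih, Finset.Nat.sum_antidiagonal_succ, smul_add, smul_mul_assoc, one_mul,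
      mul_smul_comm, Finset.mul_sum, pow_zero]
    simp only [Algebra.TensorProduct.tmul_mul_tmul, one_mul, ← pow_succ']

lemma IsBiderivation.add {D E : F →ₗ[ℂ] F ⊗[ℂ] F} (hD : IsBiderivation D)
    (hE : IsBiderivation E) : IsBiderivation (D + E) := fun p q => by
  rw [LinearMap.add_apply, hD, hE, LinearMap.add_apply, LinearMap.add_apply, add_mul, mul_add]
  abel

lemma IsBiderivation.smul {D : F →ₗ[ℂ] F ⊗[ℂ] F} (hD : IsBiderivation D) (c : ℂ) :
    IsBiderivation (c • D) := fun p q => by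
  rw [LinearMap.smul_apply, hD, LinearMap.smul_apply, LinearMap.smul_apply, smul_add,
    smul_mul_assoc, mul_smul_comm]

/-- The sum of `d l * φ (u * v) * φ v'` over all ways of writing the word `w` as `v l v'`. -/
noncomputable def splitSum (φ : F →ₗ[ℂ] ℂ) (z : L → F) (d : L → ℂ) : F → List L → ℂ
  | _, [] => 0
  | u, l :: w => d l * (φ u * φ (w.map z).prod) + splitSum φ z d (u * z l) w

lemma IsBiderivation.tensorSquare_word {D : F →ₗ[ℂ] F ⊗[ℂ] F} (hD : IsBiderivation D)
    (φ : F →ₗ[ℂ] ℂ) {z : L → F} {d : L → ℂ} (hz : ∀ l, D (z l) = d l • 1) (w : List L) :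
    ∀ u, tensorSquare φ ((u ⊗ₜ 1) * D (w.map z).prod) = splitSum φ z d u w := by
  induction w with
  | nil => intro u; rw [List.map_nil, List.prod_nil, hD.map_one, mul_zero, map_zero, splitSum]
  | cons l w ih =>
    intro u
    rw [List.map_cons, List.prod_cons, hD, mul_add, map_add, ← mul_assoc (_ ⊗ₜ[ℂ] _) (_ ⊗ₜ[ℂ] _),
      Algebra.TensorProduct.tmul_mul_tmul, one_mul, ih, hz, smul_mul_assoc, one_mul, mul_smul_comm,
      Algebra.TensorProduct.tmul_mul_tmul, mul_one, one_mul, map_smul, tensorSquare_tmul, splitSum,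
      smul_eq_mul]

lemma splitSum_comp {A : Type*} [Ring A] [Algebra ℂ A] (τ : A →ₗ[ℂ] ℂ) (e : F →ₐ[ℂ] A)
    (z : L → F) (d : L → ℂ) (w : List L) : ∀ u,
    splitSum (τ ∘ₗ e.toLinearMap) z d u w = splitSum τ (e ∘ z) d (e u) w := by
  induction w with
  | nil => intro u; rfl
  | cons l w ih =>
    intro u
    rw [splitSum, splitSum, ih, map_mul]
    simp [map_list_prod]

/-- A word form of a Schwinger-Dyson equation. -/
lemma splitSum_of_schwingerDyson {A : Type*} [Ring A] [Algebra ℂ A] (τ : A →ₗ[ℂ] ℂ)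
    (e : F →ₐ[ℂ] A) {D : F →ₗ[ℂ] F ⊗[ℂ] F} (hD : IsBiderivation D) {s : F} {P : Subalgebra ℂ F}
    (hsd : ∀ p ∈ P, (τ ∘ₗ e.toLinearMap) (s * p) = tensorSquare (τ ∘ₗ e.toLinearMap) (D p))
    {z : L → F} (hz : ∀ l, z l ∈ P) {d : L → ℂ} (hd : ∀ l, D (z l) = d l • 1) (w : List L) :
    τ (e s * (w.map (e ∘ z)).prod) = splitSum τ (e ∘ z) d 1 w := by
  have h := hsd (w.map z).prod (list_prod_mem (by simpa using fun l _ => hz l))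
  have h2 := hD.tensorSquare_word (τ ∘ₗ e.toLinearMap) hd w 1
  rw [← Algebra.TensorProduct.one_def, one_mul, ← h, splitSum_comp, map_one] at h2
  rw [← h2, LinearMap.comp_apply, AlgHom.toLinearMap_apply, map_mul e, map_list_prod e,
    List.map_map]

end Biderivations

/-! ### Semicircular elements -/

section Semicircular

variable {A : Type*} [CStarAlgebra A] {τ : A →ₗ[ℂ] ℂ}
variable {F : Type*} [Ring F] [Algebra ℂ F] {ι : Type*}

/-- Pulls freeness back along `e`, so that the argument can run in an algebra carrying the required
derivations. -/
lemma FreeSubalgebras.isFreeFamily {B : ι → StarSubalgebra ℂ A} (h : FreeSubalgebras τ B)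
    (e : F →ₐ[ℂ] A) {B' : ι → Subalgebra ℂ F} (hB : ∀ i, ∀ x ∈ B' i, e x ∈ B i) :
    IsFreeFamily (τ ∘ₗ e.toLinearMap) B' := by
  intro l hl hl'
  have h2 := h (l.map (Prod.map id e)) (by simpa using hl) ?_ ?_
  · rw [List.map_map] at h2
    rw [LinearMap.comp_apply, AlgHom.toLinearMap_apply, map_list_prod, List.map_map]
    exact h2
  · intro p hp
    obtain ⟨q, hq, rfl⟩ := List.mem_map.mp hp
    exact ⟨hB _ _ (hl'.1 q hq).1, (hl'.1 q hq).2⟩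
  · rw [List.isChain_map]
    exact hl'.2

lemma map_mem_of_mem_adjoin (e : F →ₐ[ℂ] A) {s : Set F} {B : StarSubalgebra ℂ A}
    (h : ∀ x ∈ s, e x ∈ B) {x : F} (hx : x ∈ Algebra.adjoin ℂ s) : e x ∈ B :=
  (Algebra.adjoin_le (S := B.toSubalgebra.comap e) h) hx

/-- On powers of `x` this is the moment recursion `integral_semicircleLaw_add_two`, because `D (x ^
(n + 1))` is `t` times the sum of all `x ^ i ⊗ x ^ j` with `i + j = n`. -/
lemma schwingerDyson_adjoin_singleton {φ : F →ₗ[ℂ] ℂ} {D : F →ₗ[ℂ] F ⊗[ℂ] F}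
    (hD : IsBiderivation D) {x : F} {t : ℝ} (ht : 0 ≤ t) (hDx : D x = (t : ℂ) • 1)
    (hx : ∀ n : ℕ, φ (x ^ n) = ((∫ s : ℝ, s ^ n ∂semicircleLaw t : ℝ) : ℂ)) {p : F}
    (hp : p ∈ Algebra.adjoin ℂ {x}) : φ (x * p) = tensorSquare φ (D p) := by
  rw [Algebra.adjoin_singleton_eq_range_aeval] at hp
  obtain ⟨q, rfl⟩ := hp
  change φ (x * Polynomial.aeval x q) = tensorSquare φ (D (Polynomial.aeval x q))
  induction q using Polynomial.induction_on' with
  | add p q hp hq => simp only [map_add, mul_add, hp, hq]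
  | monomial n c =>
    rw [Polynomial.aeval_monomial, ← Algebra.smul_def, mul_smul_comm, map_smul, map_smul, map_smul,
      ← pow_succ', hx]
    congr 1
    rcases n with _ | n
    · rw [pow_zero, hD.map_one, map_zero, integral_semicircleLaw_one, Complex.ofReal_zero]
    · rw [hD.map_pow hDx, integral_semicircleLaw_add_two ht, map_smul, map_sum]
      simp only [tensorSquare_tmul, hx]
      push_cast
      rw [smul_eq_mul]

/-- The Schwinger-Dyson equation for a semicircular element which is one of several free
elements. -/
lemma schwingerDyson_semicircular (hτ : τ 1 = 1) {t : ℝ} (ht : 0 ≤ t) {x : ι → A}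
    (hx : StarFree τ x) {i : ι} (hi : IsSemicircular τ t (x i)) (e : F →ₐ[ℂ] A) {z : ι → F}
    (hz : ∀ j, e (z j) = x j) {D : F →ₗ[ℂ] F ⊗[ℂ] F} (hD : IsBiderivation D)
    (hDi : D (z i) = (t : ℂ) • 1) (hDj : ∀ j ≠ i, D (z j) = 0) {p : F}
    (hp : p ∈ Algebra.adjoin ℂ (Set.range z)) :
    (τ ∘ₗ e.toLinearMap) (z i * p) = tensorSquare (τ ∘ₗ e.toLinearMap) (D p) := by
  have hfree : IsFreeFamily (τ ∘ₗ e.toLinearMap) (fun j => Algebra.adjoin ℂ {z j}) := by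
    refine FreeSubalgebras.isFreeFamily hx e fun j y hy => map_mem_of_mem_adjoin e ?_ hy
    rintro _ rfl
    rw [hz]
    exact StarAlgebra.self_mem_adjoin_singleton ℂ _
  refine schwingerDyson_iSup (i := i) (by simpa using hτ) hfree hD ?_ ?_
    (Algebra.self_mem_adjoin_singleton ℂ _) ?_ ?_
  · intro y hy
    refine hD.map_mem rfl ?_ hy
    rintro _ rfl
    exact ⟨_, hDi⟩
  · intro j hj y hy
    refine hD.eq_zero_of_adjoin ?_ hy
    rintro _ rfl
    exact hDj j hj
  · intro y hy
    refine schwingerDyson_adjoin_singleton hD ht hDi (fun n => ?_) hy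
    rw [← hi.moments n, ← hz, ← map_pow]
    rfl
  · refine Algebra.adjoin_le ?_ hp
    rintro _ ⟨j, rfl⟩
    exact (le_iSup (fun j => Algebra.adjoin ℂ {z j}) j) (Algebra.self_mem_adjoin_singleton ℂ _)

/-- The Schwinger-Dyson equation for words in `a` and a free semicircular element `S`. -/
theorem semicircular_word (hτ : τ 1 = 1) {t : ℝ} (ht : 0 ≤ t) {a S : A}
    (hS : IsSemicircular τ t S) (haS : StarFree τ ![a, S]) (w : List Bool) :
    τ (S * (w.map fun b => cond b S a).prod) =
      splitSum τ (fun b => cond b S a) (fun b => cond b (t : ℂ) 0) 1 w := by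
  obtain ⟨D, hD, hDι⟩ := exists_isBiderivation (fun b => cond b (t : ℂ) 0)
  set e : FreeAlgebra ℂ Bool →ₐ[ℂ] A := FreeAlgebra.lift ℂ fun b => cond b S a with he
  have h := splitSum_of_schwingerDyson τ e hD (s := FreeAlgebra.ι ℂ true)
    (fun p hp => schwingerDyson_semicircular hτ ht haS (i := 1) hS e
      (z := ![FreeAlgebra.ι ℂ false, FreeAlgebra.ι ℂ true])
      (by intro j; fin_cases j <;> simp [e]) hD (hDι true)
      (by intro j hj; fin_cases j
          · simpa using hDι false
          · exact absurd rfl hj) hp)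
    (z := FreeAlgebra.ι ℂ) (by
      rintro (_ | _)
      · exact Algebra.subset_adjoin ⟨0, rfl⟩
      · exact Algebra.subset_adjoin ⟨1, rfl⟩) hDι w
  rw [he, FreeAlgebra.ι_comp_lift, FreeAlgebra.lift_ι_apply] at h
  exact h

end Semicircular

/-! ### Circular elements -/

section Circular

variable {A : Type*} [CStarAlgebra A] {τ : A →ₗ[ℂ] ℂ}

/-- The letters `q`, `C` and `C*`. -/
def circEval (q C : A) : Option Bool → A
  | none => q
  | some false => C
  | some true => star C

/-- The covariance between `C`, `C*` and the letters `q`, `C`, `C*`. -/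
noncomputable def circCov (t : ℝ) (b : Bool) : Option Bool → ℂ
  | none => 0
  | some c => if b = c then 0 else t

/-- The sign of the imaginary part in `C` and `C*`. -/
noncomputable def conjSign (b : Bool) : ℂ := cond b (-Complex.I) Complex.I

lemma conjSign_mul (b c : Bool) : conjSign b * conjSign c = if b = c then -1 else 1 := by
  cases b <;> cases c <;> simp [conjSign]

/-- The equations for `X` and `Y` hold on the algebra of `X, Y` by their mutual freeness, then on
the algebra of `q, X, Y` because `X` and `Y` are in the *-algebra of `C`, which is free from `q`.
Their combination gives the equation for `C` or `C*`. -/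
lemma circular_word_of_mem_adjoin (hτ : τ 1 = 1) {t : ℝ} (ht : 0 ≤ t) {a C q : A}
    (hC : IsCircular τ t C) (haC : StarFree τ ![a, C]) (hq : q ∈ StarAlgebra.adjoin ℂ {a})
    (b : Bool) (w : List (Option Bool)) :
    τ (circEval q C (some b) * (w.map (circEval q C)).prod) =
      splitSum τ (circEval q C) (circCov t b) 1 w := by
  obtain ⟨X, Y, hX, hY, hXY, hCXY⟩ := hC
  have hX' := hX.isSelfAdjoint.star_eq
  have hY' := hY.isSelfAdjoint.star_eq
  have hstar : star C = X - Complex.I • Y := by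
    rw [hCXY, star_add, star_smul, hX', hY', Complex.star_def, Complex.conj_I, neg_smul,
      sub_eq_add_neg]
  have hC1 : C ∈ StarAlgebra.adjoin ℂ {C} := StarAlgebra.self_mem_adjoin_singleton ℂ C
  have hX1 : X ∈ StarAlgebra.adjoin ℂ {C} := by
    have : X = (1 / 2 : ℂ) • (C + star C) := by rw [hstar, hCXY]; module
    rw [this]
    exact SMulMemClass.smul_mem _ (add_mem hC1 (star_mem hC1))
  have hY1 : Y ∈ StarAlgebra.adjoin ℂ {C} := by
    have : Y = (-Complex.I / 2 : ℂ) • (C - star C) := by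
      rw [hstar, hCXY, add_sub_sub_cancel, ← two_smul ℂ, smul_smul, smul_smul]
      ring_nf
      simp
    rw [this]
    exact SMulMemClass.smul_mem _ (sub_mem hC1 (star_mem hC1))
  set e : FreeAlgebra ℂ (Fin 3) →ₐ[ℂ] A := FreeAlgebra.lift ℂ ![q, X, Y] with he
  set v : Fin 3 → FreeAlgebra ℂ (Fin 3) := FreeAlgebra.ι ℂ with hv
  have hev : ∀ j, e (v j) = ![q, X, Y] j := fun j => FreeAlgebra.lift_ι_apply _ _
  set P : Subalgebra ℂ (FreeAlgebra ℂ (Fin 3)) := Algebra.adjoin ℂ (Set.range ![v 1, v 2]) with hP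
  have hXP : v 1 ∈ P := Algebra.subset_adjoin ⟨0, rfl⟩
  have hYP : v 2 ∈ P := Algebra.subset_adjoin ⟨1, rfl⟩
  have hfree : IsFreeFamily (τ ∘ₗ e.toLinearMap) ![Algebra.adjoin ℂ {v 0}, P] := by
    refine FreeSubalgebras.isFreeFamily haC e fun j y hy => ?_
    fin_cases j
    · refine map_mem_of_mem_adjoin e ?_ hy
      rintro _ rfl
      rw [hev]
      exact hq
    · refine map_mem_of_mem_adjoin e ?_ hy
      rintro _ ⟨k, rfl⟩
      fin_cases k
      · exact (hev 1).symm ▸ hX1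
      · exact (hev 2).symm ▸ hY1
  have hht : 0 ≤ t / 2 := by positivity
  have key : ∀ {D : FreeAlgebra ℂ (Fin 3) →ₗ[ℂ] FreeAlgebra ℂ (Fin 3) ⊗[ℂ] FreeAlgebra ℂ (Fin 3)}
      {d : Fin 3 → ℂ} {s : FreeAlgebra ℂ (Fin 3)}, IsBiderivation D → (∀ j, D (v j) = d j • 1) →
      d 0 = 0 → s ∈ P →
      (∀ p ∈ P, (τ ∘ₗ e.toLinearMap) (s * p) = tensorSquare (τ ∘ₗ e.toLinearMap) (D p)) →
      ∀ p ∈ ⨆ j, (![Algebra.adjoin ℂ {v 0}, P] : Fin 2 → _) j,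
        (τ ∘ₗ e.toLinearMap) (s * p) = tensorSquare (τ ∘ₗ e.toLinearMap) (D p) := by
    intro D d s hD hd hd0 hs hsd p hp
    refine schwingerDyson_iSup (i := 1) (by simpa using hτ) hfree hD ?_ ?_ hs hsd hp
    · intro y hy
      refine hD.map_mem hP ?_ hy
      rintro _ ⟨k, rfl⟩
      fin_cases k
      · exact ⟨_, hd 1⟩
      · exact ⟨_, hd 2⟩
    · intro j hj y hy
      fin_cases j
      · refine hD.eq_zero_of_adjoin ?_ hy
        rintro _ rfl
        rw [hd, hd0, zero_smul]
      · exact absurd rfl hj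
  have hezXY : ∀ j, e ((![v 1, v 2] : Fin 2 → _) j) = (![X, Y] : Fin 2 → A) j := by
    intro j
    fin_cases j
    · exact hev 1
    · exact hev 2
  obtain ⟨D, hD, hDι⟩ := exists_isBiderivation ![(0 : ℂ), ((t / 2 : ℝ) : ℂ), 0]
  obtain ⟨E, hE, hEι⟩ := exists_isBiderivation ![(0 : ℂ), 0, ((t / 2 : ℝ) : ℂ)]
  have hDsd := key hD hDι rfl hXP fun p hp =>
    schwingerDyson_semicircular hτ hht hXY (i := 0) hX e hezXY hD (hDι 1) (by
      intro j hj
      fin_cases j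
      · exact absurd rfl hj
      · simpa using hDι 2) hp
  have hEsd := key hE hEι rfl hYP fun p hp =>
    schwingerDyson_semicircular hτ hht hXY (i := 1) hY e hezXY hE (hEι 2) (by
      intro j hj
      fin_cases j
      · simpa using hEι 1
      · exact absurd rfl hj) hp
  let z : Option Bool → FreeAlgebra ℂ (Fin 3)
    | none => v 0
    | some c => v 1 + conjSign c • v 2
  have hez : e ∘ z = circEval q C := by
    ext l
    rcases l with _ | _ | _
    · exact hev 0
    · simp only [Function.comp_apply, z, map_add, map_smul, hev, circEval, hCXY, conjSign]
      rfl
    · simp only [Function.comp_apply, z, map_add, map_smul, hev, circEval, hstar, conjSign,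
        sub_eq_add_neg, ← neg_smul]
      rfl
  have hzP : ∀ l, z l ∈ ⨆ j, (![Algebra.adjoin ℂ {v 0}, P] : Fin 2 → _) j := by
    have h0 := le_iSup (![Algebra.adjoin ℂ {v 0}, P] : Fin 2 → _) 0
    have h1 := le_iSup (![Algebra.adjoin ℂ {v 0}, P] : Fin 2 → _) 1
    rintro (_ | c)
    · exact h0 (Algebra.self_mem_adjoin_singleton ℂ _)
    · exact h1 (add_mem hXP (P.smul_mem hYP _))
  -- With signs `±i` in `X ± iY`, the derivation for letter `b` takes the value `(t / 2) (1 +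
  -- conjSign b * conjSign c)` at letter `c`: zero if `b = c`, and `t` otherwise.
  have h := splitSum_of_schwingerDyson τ e (hD.add (hE.smul (conjSign b))) (s := z (some b))
    (z := z) (d := circCov t b) (fun p hp => ?_) hzP ?_ w
  · have hb : e (z (some b)) = circEval q C (some b) := congrFun hez (some b)
    rwa [hez, hb] at h
  · simp only [z, add_mul, smul_mul_assoc, map_add, map_smul, LinearMap.add_apply,
      LinearMap.smul_apply, hDsd p hp, hEsd p hp]
  · rintro (_ | c)
    · have h1 := hDι 0
      have h2 := hEι 0
      simp only [LinearMap.add_apply, LinearMap.smul_apply, z, hv, h1, h2, circCov]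
      simp
    · have h1 : D (v 1) = ((t / 2 : ℝ) : ℂ) • 1 := hDι 1
      have h2 : D (v 2) = (0 : ℂ) • 1 := hDι 2
      have h3 : E (v 1) = (0 : ℂ) • 1 := hEι 1
      have h4 : E (v 2) = ((t / 2 : ℝ) : ℂ) • 1 := hEι 2
      simp only [LinearMap.add_apply, LinearMap.smul_apply, z, map_add, map_smul, h1, h2, h3, h4,
        circCov, smul_smul, ← add_smul]
      congr 1
      have h5 := conjSign_mul b c
      split_ifs at h5 ⊢
      · push_cast
        linear_combination (t / 2 : ℂ) * h5
      · push_cast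
        linear_combination (t / 2 : ℂ) * h5

lemma continuous_word (C : A) (w : List (Option Bool)) :
    Continuous fun q => (w.map (circEval q C)).prod := by
  have hl : ∀ l, Continuous fun q => circEval q C l := by
    rintro (_ | _ | _)
    exacts [continuous_id, continuous_const, continuous_const]
  induction w with
  | nil => simpa using continuous_const
  | cons l w ih =>
    simp only [List.map_cons, List.prod_cons]
    exact (hl l).mul ih

lemma continuous_splitSum (hτ : Continuous τ) (C : A) (d : Option Bool → ℂ)
    (w : List (Option Bool)) : ∀ u : A → A, Continuous u →
    Continuous fun q => splitSum τ (circEval q C) d (u q) w := by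
  have hl : ∀ l, Continuous fun q => circEval q C l := by
    rintro (_ | _ | _)
    exacts [continuous_id, continuous_const, continuous_const]
  induction w with
  | nil => intro u _; exact continuous_const
  | cons l w ih =>
    intro u hu
    simp only [splitSum]
    exact (continuous_const.mul ((hτ.comp hu).mul (hτ.comp (continuous_word C w)))).add
      (ih _ (hu.mul (hl l)))

/-- The Schwinger-Dyson equation for words in `q`, `C` and `C*`, with `C` circular and free from
`a`, and `q` in the C*-algebra generated by `a`. -/
theorem circular_word (hτ : τ 1 = 1) (hτc : Continuous τ) {t : ℝ} (ht : 0 ≤ t) {a C q : A}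
    (hC : IsCircular τ t C) (haC : StarFree τ ![a, C]) (hq : q ∈ StarAlgebra.elemental ℂ a)
    (b : Bool) (w : List (Option Bool)) :
    τ (circEval q C (some b) * (w.map (circEval q C)).prod) =
      splitSum τ (circEval q C) (circCov t b) 1 w := by
  -- Both sides are continuous in `q`, so the identity passes from the algebraic *-algebra of `a` to
  -- its closure. This is needed for `q = |a|`, which need not be a polynomial in `a`.
  have hclosed : IsClosed {q : A | τ (circEval q C (some b) * (w.map (circEval q C)).prod) =
      splitSum τ (circEval q C) (circCov t b) 1 w} :=
    isClosed_eq (hτc.comp (continuous_word C (some b :: w)))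
      (continuous_splitSum hτc C _ w _ continuous_const)
  exact closure_minimal (fun q hq => circular_word_of_mem_adjoin hτ ht hC haC hq b w) hclosed hq

end Circular


/-! ### Comparing words in `a, S` with words in `q, C*, C` -/

section Words

variable {A : Type*} [CStarAlgebra A] {τ : A →ₗ[ℂ] ℂ}

/-- Replace the letters `true` of a word by `C*` and `C` according to the parity of their
position. -/
def parityLabel : Bool → List Bool → List (Option Bool)
  | _, [] => []
  | p, l :: w => (cond l (some p) none) :: parityLabel (!p) w

lemma parityLabel_append (u v : List Bool) : ∀ p,
    parityLabel p (u ++ v) = parityLabel p u ++ parityLabel (p ^^ u.length.bodd) v := by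
  induction u with
  | nil => intro p; simp [parityLabel]
  | cons l u ih =>
    intro p
    rw [List.cons_append, parityLabel, parityLabel, ih, List.cons_append, List.length_cons,
      Nat.bodd_succ]
    cases p <;> cases u.length.bodd <;> rfl

variable (τ) in
/-- The trace of a word in `a` and `S`. -/
noncomputable def traceWord (a S : A) (w : List Bool) : ℂ := τ (w.map fun b => cond b S a).prod

variable (τ) in
/-- The trace of a word in `q`, `C*` and `C`, where `C*` and `C` are placed by parity. -/
noncomputable def traceParityWord (q C : A) (p : Bool) (w : List Bool) : ℂ :=
  τ ((parityLabel p w).map (circEval q C)).prod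

lemma traceWord_rotate (hτ : ∀ x y, τ (x * y) = τ (y * x)) (a S : A) (u v : List Bool) :
    traceWord τ a S (u ++ v) = traceWord τ a S (v ++ u) := by
  simp only [traceWord, List.map_append, List.prod_append]
  exact hτ _ _

/-- Even length makes the parity labels consistent around the cycle, so traciality only changes the
starting label. -/
lemma traceParityWord_rotate (hτ : ∀ x y, τ (x * y) = τ (y * x)) (q C : A) (p : Bool)
    (u v : List Bool) (h : (u ++ v).length.bodd = false) :
    traceParityWord τ q C p (u ++ v) =
      traceParityWord τ q C (p ^^ u.length.bodd) (v ++ u) := by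
  have h2 : ((p ^^ u.length.bodd) ^^ v.length.bodd) = p := by
    rw [List.length_append, Nat.bodd_add] at h
    rw [Bool.xor_assoc, h, Bool.xor_false]
  simp only [traceParityWord, parityLabel_append, h2, List.map_append, List.prod_append]
  exact hτ _ _

/-- Removing one letter from a word of even length leaves two pieces of opposite parity, and the odd
one has trace zero. The prefix `u` collects letters already passed. -/
lemma splitSum_eq_zero {t : ℂ} {a S : A} (v : List Bool) : ∀ u : List Bool,
    (∀ w : List Bool, w.count true < (u ++ v).count true + 1 → w.length.bodd = true →
      traceWord τ a S w = 0) →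
    (u ++ v).length.bodd = false →
    splitSum τ (fun b => cond b S a) (fun b => cond b t 0) (u.map fun b => cond b S a).prod v
      = 0 := by
  induction v with
  | nil => intro u _ _; rfl
  | cons l v ih =>
    intro u hIH hodd
    have h := ih (u ++ [l]) (by simpa using hIH) (by simpa using hodd)
    rw [List.map_append, List.prod_append, List.map_singleton, List.prod_singleton] at h
    rw [splitSum, h, add_zero]
    cases l
    · exact zero_mul _
    · simp only [List.count_append, List.count_cons_self] at hIH
      rw [List.length_append, List.length_cons, ← add_assoc, Nat.bodd_succ, Nat.bodd_add] at hodd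
      rcases hu : u.length.bodd with _ | _
      · have hv : traceWord τ a S v = 0 := hIH v (by omega) (by simpa [hu] using hodd)
        rw [traceWord] at hv
        rw [hv, mul_zero, mul_zero]
      · have hu : traceWord τ a S u = 0 := hIH u (by omega) hu
        rw [traceWord] at hu
        rw [hu, zero_mul, mul_zero]

/-- The letter removed in front carried the label `p`, so labels restart at `!p`. The two pieces
around a letter `S` have equal parity. If both are odd, the semicircular term vanishes and the
letter is labelled `p`, with covariance zero. If both are even, it is labelled `!p`, with covariance
`t`, and the traces of the pieces agree. -/
lemma splitSum_eq_splitSum {t : ℝ} {a S q C : A} (p : Bool) (v : List Bool) : ∀ u : List Bool,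
    (∀ w : List Bool, w.count true < (u ++ v).count true + 1 →
      (w.length.bodd = true → traceWord τ a S w = 0) ∧
      (w.length.bodd = false → ∀ p, traceWord τ a S w = traceParityWord τ q C p w)) →
    (u ++ v).length.bodd = true →
    splitSum τ (fun b => cond b S a) (fun b => cond b (t : ℂ) 0)
      (u.map fun b => cond b S a).prod v =
    splitSum τ (circEval q C) (circCov t p) ((parityLabel (!p) u).map (circEval q C)).prod
      (parityLabel ((!p) ^^ u.length.bodd) v) := by
  induction v with
  | nil => intro u _ _; rfl
  | cons l v ih =>
    intro u hIH hodd
    have h := ih (u ++ [l]) (by simpa using hIH) (by simpa using hodd)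
    rw [List.map_append, List.prod_append, List.map_singleton, List.prod_singleton,
      parityLabel_append, List.map_append, List.prod_append, List.length_append, Nat.bodd_add] at h
    simp only [parityLabel, List.map_singleton, List.prod_singleton, List.length_singleton,
      Nat.bodd_one, Bool.xor_true] at h
    rw [parityLabel, splitSum, splitSum, h, ← Bool.xor_not (!p)]
    congr 1
    cases l
    · simp [circCov]
    · simp only [List.count_append, List.count_cons_self] at hIH
      rw [List.length_append, List.length_cons, ← add_assoc, Nat.bodd_succ, Nat.bodd_add] at hodd
      rcases hu : u.length.bodd with _ | _
      · have hv : v.length.bodd = false := by simpa [hu] using hodd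
        have h1 := (hIH u (by omega)).2 hu (!p)
        have h2 := (hIH v (by omega)).2 hv p
        simp only [traceWord, traceParityWord] at h1 h2
        rw [h1, h2]
        cases p <;> simp [circCov]
      · have h1 : traceWord τ a S u = 0 := (hIH u (by omega)).1 hu
        rw [traceWord] at h1
        rw [h1, zero_mul, mul_zero]
        cases p <;> simp [circCov]

lemma parityLabel_replicate (n : ℕ) : ∀ p,
    parityLabel p (List.replicate n false) = List.replicate n none := by
  induction n with
  | zero => intro p; rfl
  | succ n ih => intro p; rw [List.replicate_succ, parityLabel, ih]; rfl

/-- Words of odd length in `a`, `S` have trace zero, and for words of even length `S` may be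
replaced by `C*`, `C` according to parity. -/
theorem traceWord_eq (hτ : ∀ x y, τ (x * y) = τ (y * x)) {t : ℝ} {a S q C : A}
    (hodd : ∀ n : ℕ, n.bodd = true → τ (a ^ n) = 0)
    (heven : ∀ n : ℕ, n.bodd = false → τ (a ^ n) = τ (q ^ n))
    (hS : ∀ w : List Bool, τ (S * (w.map fun b => cond b S a).prod) =
      splitSum τ (fun b => cond b S a) (fun b => cond b (t : ℂ) 0) 1 w)
    (hC : ∀ (b : Bool) (w : List (Option Bool)),
      τ (circEval q C (some b) * (w.map (circEval q C)).prod) =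
        splitSum τ (circEval q C) (circCov t b) 1 w) (k : ℕ) :
    ∀ w : List Bool, w.count true = k →
      (w.length.bodd = true → traceWord τ a S w = 0) ∧
      (w.length.bodd = false → ∀ p, traceWord τ a S w = traceParityWord τ q C p w) := by
  induction k using Nat.strong_induction_on with
  | _ k ih =>
    intro w hw
    by_cases hmem : true ∈ w
    · obtain ⟨u, v, rfl⟩ := List.append_of_mem hmem
      have hlen : (u ++ true :: v).length = (v ++ u).length + 1 := by
        simp only [List.length_append, List.length_cons]; omega
      have hIH : ∀ w : List Bool, w.count true < ([] ++ (v ++ u)).count true + 1 →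
          (w.length.bodd = true → traceWord τ a S w = 0) ∧
          (w.length.bodd = false → ∀ p, traceWord τ a S w = traceParityWord τ q C p w) := by
        intro w' hw'
        refine ih _ ?_ w' rfl
        simp only [List.count_append, List.count_cons_self, List.nil_append] at hw hw'
        omega
      -- Rotate a letter `S` to the front and remove it.
      have hf : traceWord τ a S (u ++ true :: v) =
          splitSum τ (fun b => cond b S a) (fun b => cond b (t : ℂ) 0) 1 (v ++ u) := by
        rw [traceWord_rotate hτ, List.cons_append, traceWord, List.map_cons, List.prod_cons, ← hS]
        rfl
      constructor
      · intro hl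
        rw [hlen, Nat.bodd_succ, Bool.not_eq_true'] at hl
        rw [hf]
        exact splitSum_eq_zero (v ++ u) [] (fun w hw => (hIH w hw).1) hl
      · intro hl p
        rw [traceParityWord_rotate hτ _ _ _ _ _ hl, hf]
        rw [hlen, Nat.bodd_succ, Bool.not_eq_false'] at hl
        set p' := p ^^ u.length.bodd
        have h := splitSum_eq_splitSum (τ := τ) (t := t) p' (v ++ u) [] hIH hl
        rw [List.cons_append, traceParityWord, parityLabel, List.map_cons, List.prod_cons]
        simp only [List.map_nil, List.prod_nil, parityLabel, List.length_nil, Nat.bodd_zero,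
          Bool.xor_false] at h
        rw [h, ← hC]
        rfl
    · have hrep : w = List.replicate w.length false :=
        List.eq_replicate_iff.mpr ⟨rfl, fun b hb => by
          cases b
          · rfl
          · exact absurd hb hmem⟩
      have h1 : traceWord τ a S w = τ (a ^ w.length) := by
        rw [traceWord, hrep, List.map_replicate, List.prod_replicate, List.length_replicate]
        rfl
      refine ⟨fun hl => by rw [h1, hodd _ hl], fun hl p => ?_⟩
      rw [h1, heven _ hl, traceParityWord, hrep, parityLabel_replicate, List.map_replicate,
        List.prod_replicate, List.length_replicate]
      rfl

/-- The alternating product `(q + C*) (q + C) (q + C*) ⋯` with `n` factors. -/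
noncomputable def alternatingProd (q C : A) : Bool → ℕ → A
  | _, 0 => 1
  | p, n + 1 => (q + circEval q C (some p)) * alternatingProd q C (!p) n

lemma alternatingProd_two_mul (q C : A) (n : ℕ) :
    alternatingProd q C true (2 * n) = ((q + star C) * (q + C)) ^ n := by
  induction n with
  | zero => rw [pow_zero]; rfl
  | succ n ih =>
    rw [pow_succ', ← ih, mul_assoc]
    rfl

/-- Expands the power one factor at a time: each factor appends either letter to the prefix `w`,
whose parity dictates whether the matching factor is `q + C*` or `q + C`. -/
lemma map_mul_pow_eq {a S q C : A}
    (h : ∀ w : List Bool, w.length.bodd = false →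
      ∀ p, traceWord τ a S w = traceParityWord τ q C p w) (p : Bool) (n : ℕ) : ∀ w : List Bool,
    (w.length + n).bodd = false →
    τ ((w.map fun b => cond b S a).prod * (a + S) ^ n) =
      τ (((parityLabel p w).map (circEval q C)).prod *
        alternatingProd q C (p ^^ w.length.bodd) n) := by
  induction n with
  | zero => intro w hw; simpa [alternatingProd] using! h w hw p
  | succ n ih =>
    intro w hw
    have h1 := ih (w ++ [false]) (by
      rw [List.length_append, List.length_singleton, add_assoc, add_comm 1]; exact hw)
    have h2 := ih (w ++ [true]) (by
      rw [List.length_append, List.length_singleton, add_assoc, add_comm 1]; exact hw)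
    simp only [List.map_append, List.prod_append, List.map_singleton, List.prod_singleton,
      parityLabel_append, List.length_append, List.length_singleton, Nat.bodd_add, Nat.bodd_one,
      Bool.xor_true, Bool.xor_not, parityLabel, cond_true, cond_false, circEval, mul_assoc]
      at h1 h2
    rw [alternatingProd, pow_succ', add_mul, add_mul, mul_add, mul_add, map_add, map_add, h1, h2]
    rfl

/-- Even moments of `a + S` agree with the moments of `(q + C)* (q + C)`. -/
theorem map_pow_eq {a S q C : A}
    (h : ∀ w : List Bool, w.length.bodd = false →
      ∀ p, traceWord τ a S w = traceParityWord τ q C p w) (n : ℕ) :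
    τ (((a + S) * (a + S)) ^ n) = τ (((q + star C) * (q + C)) ^ n) := by
  have := map_mul_pow_eq h true (2 * n) [] (by simp)
  simpa [parityLabel, alternatingProd_two_mul, ← pow_two, ← pow_mul] using this

end Words


/-! ### From moments to distributions of absolute values -/

section Distribution

open scoped ComplexOrder CompactlySupported

variable {A : Type*} [CStarAlgebra A] {τ : A →ₗ[ℂ] ℂ}

lemma IsTracialState.nonneg_star_mul_self (hτ : IsTracialState τ) (x : A) :
    0 ≤ τ (star x * x) :=
  Complex.le_def.mpr ⟨hτ.re_nonneg x, (hτ.im_eq_zero x).symm⟩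

lemma IsTracialState.im_of_isSelfAdjoint (hτ : IsTracialState τ) {x : A} (hx : IsSelfAdjoint x) :
    (τ x).im = 0 := by
  have h1 := hτ.im_eq_zero (x + 1)
  have h2 := hτ.im_eq_zero x
  rw [star_add, hx.star_eq, star_one, mul_add, add_mul, add_mul, one_mul, mul_one, one_mul,
    map_add, map_add, map_add, Complex.add_im, Complex.add_im, Complex.add_im, hτ.map_one] at h1
  rw [hx.star_eq] at h2
  rw [h2, Complex.one_im] at h1
  linarith

section Continuity

variable [PartialOrder A] [StarOrderedRing A]

lemma IsTracialState.exists_norm_le (hτ : IsTracialState τ) :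
    ∃ K : ℝ, 0 ≤ K ∧ ∀ x, ‖τ x‖ ≤ K * ‖x‖ := by
  obtain ⟨K, hK⟩ := (PositiveLinearMap.mk₀ τ fun x hx => by
    obtain ⟨y, rfl⟩ := CStarAlgebra.nonneg_iff_eq_star_mul_self.mp hx
    exact hτ.nonneg_star_mul_self y).exists_norm_apply_le
  exact ⟨K, K.2, hK⟩

lemma IsTracialState.continuous (hτ : IsTracialState τ) : Continuous τ :=
  let ⟨K, _, hK⟩ := hτ.exists_norm_le
  (τ.mkContinuous K hK).continuous

/-- If two positive elements have the same moments, then the trace agrees on all their continuous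
functions. -/
lemma IsTracialState.map_cfc_eq (hτ : IsTracialState τ) {x y : A} (hx : 0 ≤ x) (hy : 0 ≤ y)
    (hxy : ∀ n : ℕ, τ (x ^ n) = τ (y ^ n)) {f : ℝ → ℝ} (hf : Continuous f) :
    τ (cfc f x) = τ (cfc f y) := by
  obtain ⟨K, hK0, hK⟩ := hτ.exists_norm_le
  have : Nontrivial A := ⟨1, 0, fun h => by
    have h1 := hτ.map_one
    rw [h, map_zero] at h1
    exact zero_ne_one h1⟩
  set R := max ‖x‖ ‖y‖
  have hspec : ∀ z : A, 0 ≤ z → ‖z‖ ≤ R → ∀ s ∈ spectrum ℝ z, s ∈ Set.Icc 0 R := by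
    intro z hz hzR s hs
    have := (Real.le_norm_self s).trans (spectrum.norm_le_norm_of_mem hs)
    exact ⟨spectrum_nonneg_of_nonneg hz hs, this.trans hzR⟩
  have hpoly : ∀ p : Polynomial ℝ, τ (Polynomial.aeval x p) = τ (Polynomial.aeval y p) := by
    intro p
    induction p using Polynomial.induction_on' with
    | add p q hp hq => simp only [map_add, hp, hq]
    | monomial n c =>
      rw [Polynomial.aeval_monomial, Polynomial.aeval_monomial, ← Algebra.smul_def,
        ← Algebra.smul_def, LinearMap.map_smul_of_tower, LinearMap.map_smul_of_tower, hxy]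
  have happrox : ∀ (z : A), 0 ≤ z → ‖z‖ ≤ R → ∀ (p : Polynomial ℝ) (ε : ℝ), 0 < ε →
      (∀ s ∈ Set.Icc 0 R, |p.eval s - f s| < ε) →
      ‖τ (Polynomial.aeval z p) - τ (cfc f z)‖ ≤ K * ε := by
    intro z hz hzR p ε hε hp
    have hzs : IsSelfAdjoint z := .of_nonneg hz
    rw [← map_sub, ← cfc_polynomial p z, ← cfc_sub (fun s => p.eval s) f z (by fun_prop)
      hf.continuousOn]
    refine (hK _).trans (mul_le_mul_of_nonneg_left ?_ hK0)
    exact norm_cfc_le hε.le fun s hs => (hp s (hspec z hz hzR s hs)).le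
  refine eq_of_forall_dist_le fun ε hε => ?_
  -- Two approximation errors of size `K * δ` must add up to at most `ε`; the `+ 1` covers `K = 0`.
  have hδ : 0 < ε / (2 * K + 1) := by positivity
  obtain ⟨p, hp⟩ := exists_polynomial_near_of_continuousOn 0 R f hf.continuousOn _ hδ
  have h1 := happrox x hx (le_max_left _ _) p _ hδ hp
  have h2 := happrox y hy (le_max_right _ _) p _ hδ hp
  rw [← hpoly] at h2
  calc dist (τ (cfc f x)) (τ (cfc f y))
      ≤ dist (τ (cfc f x)) (τ (Polynomial.aeval x p))
        + dist (τ (Polynomial.aeval x p)) (τ (cfc f y)) := dist_triangle _ _ _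
    _ ≤ K * (ε / (2 * K + 1)) + K * (ε / (2 * K + 1)) := by
        rw [dist_comm, dist_eq_norm, dist_eq_norm]
        exact add_le_add h1 h2
    _ = 2 * K * ε / (2 * K + 1) := by ring
    _ ≤ ε := by
        rw [div_le_iff₀ (by positivity)]
        nlinarith

/-- For positive `x`, the power `x ^ n` is the continuous function `√s ^ n` of `x * x`, so odd
moments are determined by even ones. -/
lemma IsTracialState.map_pow_eq_of_sq (hτ : IsTracialState τ) {x y : A} (hx : 0 ≤ x) (hy : 0 ≤ y)
    (hxy : ∀ n : ℕ, τ ((x * x) ^ n) = τ ((y * y) ^ n)) (n : ℕ) : τ (x ^ n) = τ (y ^ n) := by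
  have key : ∀ z : A, 0 ≤ z → cfc (fun s : ℝ => √s ^ n) (z * z) = z ^ n := by
    intro z hz
    have hzs : IsSelfAdjoint z := .of_nonneg hz
    rw [← pow_two, ← cfc_comp_pow (fun s : ℝ => √s ^ n) 2 z (by fun_prop),
      ← cfc_pow_id (R := ℝ) z n]
    refine cfc_congr fun s hs => ?_
    simp only [Real.sqrt_sq (spectrum_nonneg_of_nonneg hz hs)]
  have hsq : ∀ z : A, 0 ≤ z → 0 ≤ z * z := fun z hz => by
    have := star_mul_self_nonneg z
    rwa [(IsSelfAdjoint.of_nonneg hz).star_eq] at this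
  rw [← key x hx, ← key y hy]
  exact hτ.map_cfc_eq (hsq x hx) (hsq y hy) hxy (by fun_prop)

end Continuity

/-- Every self-adjoint element has a distribution. -/
lemma IsTracialState.exists_hasDistribution (hτ : IsTracialState τ) {x : A}
    (hx : IsSelfAdjoint x) : ∃ μ : Measure ℝ, HasDistribution τ x μ := by
  -- The measure comes from the Riesz representation of `f ↦ τ (f(x))` on the compact spectrum;
  -- positivity follows by writing `f = g * g` with `g = √f`.
  let T : C_c(spectrum ℝ x, ℝ) →ₗ[ℝ] ℝ :=
    { toFun f := (τ (cfcHom hx (f : C(spectrum ℝ x, ℝ)))).re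
      map_add' f g := by
        rw [← Complex.add_re, ← map_add, ← map_add]
        rfl
      map_smul' c f := by
        change _ = c • (τ (cfcHom hx (f : C(spectrum ℝ x, ℝ)))).re
        rw [← Complex.smul_re, ← LinearMap.map_smul_of_tower, ← map_smul]
        rfl }
  let Λ : C_c(spectrum ℝ x, ℝ) →ₚ[ℝ] ℝ := PositiveLinearMap.mk₀ T (by
    intro f hf
    let g : C(spectrum ℝ x, ℝ) := ⟨fun s => √(f s), by fun_prop⟩
    have hg : (f : C(spectrum ℝ x, ℝ)) = star g * g := by
      ext s
      exact (Real.mul_self_sqrt (hf s)).symm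
    have h : T f = (τ (star (cfcHom hx g) * cfcHom hx g)).re := by
      rw [← map_star, ← map_mul, ← hg]
      rfl
    rw [h]
    exact hτ.re_nonneg _)
  set μ := RealRMK.rieszMeasure Λ
  have hmom : ∀ n : ℕ, ∫ s : spectrum ℝ x, (s : ℝ) ^ n ∂μ = (τ (x ^ n)).re := by
    intro n
    let g : C_c(spectrum ℝ x, ℝ) := CompactlySupportedContinuousMap.continuousMapEquiv
      ((ContinuousMap.id ℝ).restrict (spectrum ℝ x) ^ n)
    have h := RealRMK.integral_rieszMeasure Λ g
    have h2 : Λ g = (τ (x ^ n)).re := by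
      change (τ (cfcHom hx ((ContinuousMap.id ℝ).restrict (spectrum ℝ x) ^ n))).re = _
      rw [map_pow, cfcHom_id hx]
    rw [← h2, ← h]
    rfl
  have hmeas : MeasurableEmbedding ((↑) : spectrum ℝ x → ℝ) :=
    .subtype_coe (spectrum.isClosed x).measurableSet
  refine ⟨μ.map (↑), hx, ?_, ⟨spectrum ℝ x, spectrum.isCompact x, ?_⟩, ?_⟩
  · have h0 := hmom 0
    simp only [pow_zero, hτ.map_one, Complex.one_re, integral_const, smul_eq_mul, mul_one] at h0
    have : IsProbabilityMeasure μ := ⟨by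
      rw [measureReal_def] at h0
      exact (ENNReal.toReal_eq_one_iff _).mp h0⟩
    exact Measure.isProbabilityMeasure_map hmeas.measurable.aemeasurable
  · rw [hmeas.map_apply]
    convert measure_empty (μ := μ)
    ext s
    simp
  · intro n
    rw [hmeas.integral_map, hmom]
    exact Complex.ext rfl (hτ.im_of_isSelfAdjoint (hx.pow n))

lemma IsTracialState.sameDistribution_abs [PartialOrder A] [StarOrderedRing A]
    (hτ : IsTracialState τ) {x y : A}
    (hxy : ∀ n : ℕ, τ ((star x * x) ^ n) = τ ((star y * y) ^ n)) :
    SameDistribution τ (CFC.abs x) (CFC.abs y) := by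
  have hx := CFC.abs_nonneg x
  have hy := CFC.abs_nonneg y
  obtain ⟨μ, hμ⟩ := hτ.exists_hasDistribution (IsSelfAdjoint.of_nonneg hx)
  refine ⟨μ, hμ, .of_nonneg hy, hμ.isProbabilityMeasure, hμ.compact_support, fun n => ?_⟩
  rw [← hμ.moments n]
  exact (hτ.map_pow_eq_of_sq hx hy (by simpa only [CFC.abs_mul_abs] using hxy) n).symm

lemma IsSymmetricallyDistributed.map_pow_odd {a : A} (ha : IsSymmetricallyDistributed τ a) {n : ℕ}
    (hn : Odd n) : τ (a ^ n) = 0 := by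
  obtain ⟨μ, hμ, hsymm⟩ := ha
  have h : ∫ s, s ^ n ∂μ = -∫ s, s ^ n ∂μ := by
    conv_lhs => rw [← hsymm]
    rw [integral_map (by fun_prop) (by fun_prop), ← integral_neg]
    simp only [hn.neg_pow]
  rw [hμ.moments, self_eq_neg.mp h, Complex.ofReal_zero]

end Distribution

end FreeProb

/-! ### The theorem -/

theorem mainTheorem3 {A : Type*} [CStarAlgebra A] [PartialOrder A] [StarOrderedRing A]
    (τ : A →ₗ[ℂ] ℂ) (hτ : FreeProb.IsTracialState τ)
    (t : ℝ) (ht : 0 ≤ t) (a S C : A)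
    (ha : FreeProb.IsSymmetricallyDistributed τ a)
    (hS : FreeProb.IsSemicircular τ t S) (hC : FreeProb.IsCircular τ t C)
    (haS : FreeProb.StarFree τ ![a, S]) (haC : FreeProb.StarFree τ ![a, C]) :
    FreeProb.SameDistribution τ (CFC.abs (a + S)) (CFC.abs (CFC.abs a + C)) := by
  have hsa : IsSelfAdjoint a := let ⟨_, h, _⟩ := ha; h.isSelfAdjoint
  have habs : IsSelfAdjoint (CFC.abs a) := .of_nonneg (CFC.abs_nonneg a)
  have hmem : CFC.abs a ∈ StarAlgebra.elemental ℂ a := by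
    rw [CFC.abs_eq_cfcₙ_coe_norm ℂ a hsa.isStarNormal, cfcₙ_eq_cfc]
    exact cfc_mem_elemental _ a
  have hodd : ∀ n : ℕ, n.bodd = true → τ (a ^ n) = 0 := fun n hn =>
    ha.map_pow_odd (by rw [Nat.odd_iff, Nat.mod_two_of_bodd, hn]; rfl)
  have heven : ∀ n : ℕ, n.bodd = false → τ (a ^ n) = τ (CFC.abs a ^ n) := by
    intro n hn
    obtain ⟨k, rfl⟩ : 2 ∣ n := by
      rw [Nat.dvd_iff_mod_eq_zero, Nat.mod_two_of_bodd, hn]; rfl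
    rw [pow_mul, pow_mul, CFC.abs_sq, hsa.star_eq, pow_two]
  have hwords := fun w : List Bool => (FreeProb.traceWord_eq hτ.map_mul_comm hodd heven
    (FreeProb.semicircular_word hτ.map_one ht hS haS)
    (FreeProb.circular_word hτ.map_one hτ.continuous ht hC haC hmem) _ w rfl).2
  refine hτ.sameDistribution_abs fun n => ?_
  rw [star_add, star_add, hsa.star_eq, hS.isSelfAdjoint.star_eq, habs.star_eq]
  exact FreeProb.map_pow_eq hwords n
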